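/- Let $n\in\{2,3\}$ and let $\{\rho_\theta\}_{\theta\in\Theta}$, with $\Theta\subset\mathbb R^n$ open, be a smooth one-to-one family of density matrices on $\mathbb C^2$. Fix $\theta\in\Theta$, let $L_1,\dots,L_n$ be SLD operators at $\theta$ (Hermitian solutions of $\partial_i\rho_\theta=\frac12(\rho_\theta L_i+L_i\rho_\theta)$), and let $S=J_\theta^{\mathrm{SLD}}=\big[\frac12\mathrm{Tr}\,\rho_\theta(L_iL_j+L_jL_i)\big]_{i,j}$ be the SLD Fisher information matrix, assumed positive definite. For a POVM $\Pi=\{\Pi_x\}$ with finitely many outcomes let $J_\theta[\Pi]$ be the classical Fisher information matrix at $\theta$ of the model $p_\theta(x)=\mathrm{Tr}\,\rho_\theta\Pi_x$. For a mixed design $\mathsf e(n)=(p_i,\Pi^{(i)})_{i=1}^n$ ($p$ a probability vector, $\Pi^{(i)}$ POVMs) put $J_\theta[\mathsf e(n)]=\sum_i p_iJ_\theta[\Pi^{(i)}]$, and for a probability measure $\xi$ on the set of POVMs put $J(\xi)=\int J_\theta[\Pi]\,\xi(d\Pi)$. A design is regular if its Fisher information matrix is invertible; it is $\gamma$-optimal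 if it is regular and minimizes $\Psi_\gamma(J)=\big(\frac1n\mathrm{Tr}\,J^{-\gamma}\big)^{1/\gamma}$, evaluated at its Fisher information matrix $J$, among the regular designs. Let $\gamma>-1$, $\gamma\ne0$. Both over the mixed designs $\mathsf e(n)$ and over all probability measures $\xi$ on the set of POVMs, the minimum of $\Psi_\gamma$ over the regular designs exists and equals $$\frac1{n^{1/\gamma}}\Big(\mathrm{Tr}\,S^{-\frac{\gamma}{\gamma+1}}\Big)^{\frac{\gamma+1}{\gamma}}.$$ Let $u_1,\dots,u_n$ be any orthonormal basis of eigenvectors of $S$, with eigenvalues $\lambda_1,\dots,\lambda_n$. The mixed design that performs, with probability $p_i=\lambda_i^{-\gamma/(\gamma+1)}/\sum_j\lambda_j^{-\gamma/(\gamma+1)}$, the projective measurement of the observable $L_{u_i}=\sum_{j,k}(u_i)_j(S^{-1/2})_{jk}L_k$ exists, is $\gamma$-optimal, and attains this minimum. A design (a mixed design $\mathsf e(n)$, or a probability measure on the set of POVMs) is $\gamma$-optimal in its class if and only if its Fisher information matrix equals $$\frac{1}{\mathrm{Tr}\,S^{-\frac{\gamma}{\gamma+1}}}\;S^{\frac1{\gamma+1}}.$$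 -/

import Mathlib

open MeasureTheory
open scoped ContDiff ComplexOrder

noncomputable section

/-- The partial derivative `∂f/∂θ_i` at the point `t`. -/
def partialDeriv {n : ℕ} {F : Type*} [NormedAddCommGroup F] [NormedSpace ℝ F]
    (i : Fin n) (f : EuclideanSpace ℝ (Fin n) → F) (t : EuclideanSpace ℝ (Fin n)) : F :=
  fderiv ℝ f t (EuclideanSpace.single i 1)

/-- The real power `A ^ r` of a real symmetric matrix, by functional calculus: the eigenvectors
are kept and each eigenvalue `x` is replaced by `x ^ r`. -/
def matPow {n : ℕ} (A : Matrix (Fin n) (Fin n) ℝ) (r : ℝ) : Matrix (Fin n) (Fin n) ℝ :=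
  cfc (fun x : ℝ => x ^ r) A

/-- An `n`-parameter qubit model: a smooth one-to-one family of density matrices on `ℂ²`,
with parameter in an open subset `Θ` of `ℝⁿ`. Values of `ρ` outside `Θ` are irrelevant. -/
structure QubitModel (n : ℕ) where
  Θ : Set (EuclideanSpace ℝ (Fin n))
  ρ : EuclideanSpace ℝ (Fin n) → Matrix (Fin 2) (Fin 2) ℂ
  isOpen : IsOpen Θ
  posSemidef : ∀ t ∈ Θ, (ρ t).PosSemidef
  trace_eq_one : ∀ t ∈ Θ, (ρ t).trace = 1
  smooth : ∀ a b, ContDiffOn ℝ ∞ (fun t => ρ t a b) Θ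
  injOn : Set.InjOn ρ Θ

/-- A measurement (POVM) on a qubit with `k` outcomes. -/
structure POVM (k : ℕ) where
  elem : Fin k → Matrix (Fin 2) (Fin 2) ℂ
  posSemidef : ∀ x, (elem x).PosSemidef
  sum_eq_one : ∑ x, elem x = 1

/-- The Borel σ-algebra inherited from the matrix entries. -/
instance (k : ℕ) : MeasurableSpace (POVM k) :=
  MeasurableSpace.comap (fun P : POVM k => fun (x : Fin k) (a b : Fin 2) => P.elem x a b)
    inferInstance

/-- The design space: all qubit POVMs with any finite number of outcomes. -/
abbrev Measurement : Type := Σ k : ℕ, POVM k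

/-- `P` is the projective measurement of the observable `A`: its elements are mutually orthogonal
projections, and `A = ∑ₓ aₓ Pₓ` with distinct real numbers `aₓ`. -/
def Measurement.IsProjectiveFor (P : Measurement) (A : Matrix (Fin 2) (Fin 2) ℂ) : Prop :=
  (∀ x y, P.2.elem x * P.2.elem y = if x = y then P.2.elem x else 0) ∧
    ∃ a : Fin P.1 → ℝ, Function.Injective a ∧ A = ∑ x, (a x : ℂ) • P.2.elem x

/-- A mixed design with `m` measurements: measurement `i` is performed with relative
frequency `weight i`. -/
structure MixedDesign (m : ℕ) where
  weight : Fin m → ℝ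
  weight_mem : weight ∈ stdSimplex ℝ (Fin m)
  meas : Fin m → Measurement

namespace QubitModel

variable {n : ℕ} (M : QubitModel n)

/-- Born's rule: the probability `tr (ρ_t Π_x)` of the outcome `x`. -/
def prob (P : Measurement) (x : Fin P.1) (t : EuclideanSpace ℝ (Fin n)) : ℝ :=
  (M.ρ t * P.2.elem x).trace.re

/-- The classical Fisher information matrix `E[∂_i ℓ ∂_j ℓ]` of a measurement, with `ℓ` the log
likelihood. Outcomes of probability zero contribute nothing. -/
def fisher (θ : EuclideanSpace ℝ (Fin n)) (P : Measurement) : Matrix (Fin n) (Fin n) ℝ :=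
  Matrix.of fun i j => ∑ x, M.prob P x θ *
    (partialDeriv i (fun t => Real.log (M.prob P x t)) θ *
      partialDeriv j (fun t => Real.log (M.prob P x t)) θ)

/-- The Fisher information matrix of a mixed design. -/
def fisherMixed {m : ℕ} (θ : EuclideanSpace ℝ (Fin n)) (e : MixedDesign m) :
    Matrix (Fin n) (Fin n) ℝ :=
  ∑ i, e.weight i • M.fisher θ (e.meas i)

/-- The Fisher information matrix of a design measure, that is, of a probability measure on the
design space. -/
def fisherMeasure (θ : EuclideanSpace ℝ (Fin n)) (ξ : ProbabilityMeasure Measurement) :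
    Matrix (Fin n) (Fin n) ℝ :=
  Matrix.of fun i j => ∫ P, M.fisher θ P i j ∂(ξ : Measure Measurement)

/-- The entrywise partial derivative of the state. -/
def stateDeriv (θ : EuclideanSpace ℝ (Fin n)) (i : Fin n) : Matrix (Fin 2) (Fin 2) ℂ :=
  Matrix.of fun a b => partialDeriv i (fun t => M.ρ t a b) θ

/-- `L` is a symmetric logarithmic derivative (SLD) operator of the model at `θ` in the `i`th
direction. (It is unique if `ρ_θ` is invertible.) -/
def IsSLD (θ : EuclideanSpace ℝ (Fin n)) (i : Fin n) (L : Matrix (Fin 2) (Fin 2) ℂ) : Prop :=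
  L.IsHermitian ∧ M.stateDeriv θ i = (1 / 2 : ℂ) • (M.ρ θ * L + L * M.ρ θ)

/-- The SLD Fisher information matrix, from SLD operators `L i`. -/
def sldFisher (θ : EuclideanSpace ℝ (Fin n)) (L : Fin n → Matrix (Fin 2) (Fin 2) ℂ) :
    Matrix (Fin n) (Fin n) ℝ :=
  Matrix.of fun i j => (M.ρ θ * (L i * L j + L j * L i)).trace.re / 2

/-- The observable `L_u = ∑ i j, u_i (J^SLD)^{-1/2}_{ij} L_j`. -/
def sldObservable (θ : EuclideanSpace ℝ (Fin n)) (L : Fin n → Matrix (Fin 2) (Fin 2) ℂ)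
    (u : EuclideanSpace ℝ (Fin n)) : Matrix (Fin 2) (Fin 2) ℂ :=
  ∑ i, ∑ j, ((u i * matPow (M.sldFisher θ L) (-1 / 2) i j : ℝ) : ℂ) • L j

end QubitModel

/-- The `γ`-optimality function `((1/n) Tr J^{-γ})^{1/γ}`. -/
def gammaCriterion {n : ℕ} (γ : ℝ) (J : Matrix (Fin n) (Fin n) ℝ) : ℝ :=
  ((1 / (n : ℝ)) * (matPow J (-γ)).trace) ^ (1 / γ)

/-- The values of the optimality function `Ψ` on the regular designs of a class `D`, that is, those
with invertible Fisher information matrix. -/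
def regularValues {n : ℕ} {D : Type*} (Ψ : Matrix (Fin n) (Fin n) ℝ → ℝ)
    (J : D → Matrix (Fin n) (Fin n) ℝ) : Set ℝ :=
  {v | ∃ e : D, (J e).PosDef ∧ v = Ψ (J e)}

/-- `e` is a `Ψ`-optimal design in the class `D`: it is regular and minimizes `Ψ` among the
regular designs. -/
def IsOptimalDesign {n : ℕ} {D : Type*} (Ψ : Matrix (Fin n) (Fin n) ℝ → ℝ)
    (J : D → Matrix (Fin n) (Fin n) ℝ) (e : D) : Prop :=
  (J e).PosDef ∧ ∀ e' : D, (J e').PosDef → Ψ (J e) ≤ Ψ (J e')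

/-- `Tr (S ^ (-γ/(γ+1)))`. -/
def gammaTrace {n : ℕ} (γ : ℝ) (S : Matrix (Fin n) (Fin n) ℝ) : ℝ :=
  (matPow S (-(γ / (γ + 1)))).trace

/-- The minimal value `n^{-1/γ} (Tr S^{-γ/(γ+1)})^{(γ+1)/γ}`, for `S` the SLD Fisher information
matrix. -/
def gammaMinimum {n : ℕ} (γ : ℝ) (S : Matrix (Fin n) (Fin n) ℝ) : ℝ :=
  (1 / (n : ℝ) ^ (1 / γ)) * gammaTrace γ S ^ ((γ + 1) / γ)

/-- The matrix `S^{1/(γ+1)} / Tr S^{-γ/(γ+1)}`, for `S` the SLD Fisher information matrix. -/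
def gammaFisher {n : ℕ} (γ : ℝ) (S : Matrix (Fin n) (Fin n) ℝ) : Matrix (Fin n) (Fin n) ℝ :=
  (1 / gammaTrace γ S) • matPow S (1 / (γ + 1))

/-- `e` performs, for each `i`, the projective measurement of `L_{u_i}` with relative frequency
`lam_i^{-γ/(γ+1)} / ∑_j lam_j^{-γ/(γ+1)}`. -/
def MixedDesign.IsGammaDesign {n : ℕ} (e : MixedDesign n) (γ : ℝ) (M : QubitModel n)
    (θ : EuclideanSpace ℝ (Fin n)) (L : Fin n → Matrix (Fin 2) (Fin 2) ℂ)
    (u : Fin n → EuclideanSpace ℝ (Fin n)) (lam : Fin n → ℝ) : Prop :=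
  ∀ i, (e.meas i).IsProjectiveFor (M.sldObservable θ L (u i)) ∧
    e.weight i = lam i ^ (-(γ / (γ + 1))) / ∑ j, lam j ^ (-(γ / (γ + 1)))

end

/-!
Let `S` be the SLD Fisher information matrix. Everything follows from the inequality
`Tr (S⁻¹ J) ≤ 1` (Gill–Massar) for the Fisher information matrix `J` of any qubit measurement,
together with the fact that the matrix `gammaFisher γ S` is attained by a mixed design.

*The information bound.* With the bilinear form `⟨A, B⟩ = Re Tr (ρ (A B + B A)) / 2`, Born's rule
gives `∂ᵢpₓ = ⟨Lᵢ, Πₓ⟩`, while `⟨Lᵢ, 1⟩ = 0` and `⟨Lᵢ, Lⱼ⟩ = Sᵢⱼ`. Replacing the `Lᵢ` by an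
orthonormal family, Bessel's inequality bounds the information carried by the outcome `x` by
`(⟨Πₓ, Πₓ⟩ - pₓ²) / pₓ`. Since `Π² = Tr(Π) Π - det Π` for `2 × 2` matrices, this is at most
`Tr Πₓ - pₓ`, and the sum over the outcomes is at most `2 - 1 = 1` (`trace_infoMatrix_le_one`).
The form `⟨·,·⟩` may be degenerate, so pure states need no separate treatment. The bound is linear
in `J` and passes to mixed designs and, since `J` is bounded and measurable, to design measures.

*Attainment.* For a unit eigenvector `u` of `S`, the projective measurement of `L_u` already has
information `1` in the direction `u` after whitening. The information bound forces its other entries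
to vanish (`infoMatrix_of_isProjectiveFor`), so its Fisher information is
`S^{1/2} u uᵀ S^{1/2} = λ u uᵀ`. The prescribed mixture of these matrices is `gammaFisher γ S`.

*Optimization.* Over all positive definite `J` with `Tr (S⁻¹ J) ≤ 1`, the criterion is minimized
exactly at `gammaFisher γ S` (`gammaMinimum_le_gammaCriterion`). This is Klein's inequality for
`x ↦ x ^ (-γ)`: expanding the traces in eigenbases of `J` and `S` gives weights that form a doubly
stochastic matrix, and a scalar tangent-line inequality, a form of Bernoulli's, is summed against
these weights. Strictness of the scalar inequality gives uniqueness.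
-/

noncomputable section

/-! ### Orthogonal diagonalization and matrix powers -/

section Diagonalization

variable {n : ℕ}

theorem Matrix.IsHermitian.exists_orthogonal_diagonal {A : Matrix (Fin n) (Fin n) ℝ}
    (hA : A.IsHermitian) :
    ∃ (U : Matrix (Fin n) (Fin n) ℝ) (d : Fin n → ℝ), U.transpose * U = 1 ∧
      A = U * Matrix.diagonal d * U.transpose ∧
      ∀ f : ℝ → ℝ, cfc f A = U * Matrix.diagonal (fun i => f (d i)) * U.transpose := by
  refine ⟨hA.eigenvectorUnitary, hA.eigenvalues, ?_, ?_, fun f => ?_⟩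
  · have h := Unitary.coe_star_mul_self hA.eigenvectorUnitary
    rwa [Matrix.star_eq_conjTranspose, Matrix.conjTranspose_eq_transpose_of_trivial] at h
  · have h := hA.spectral_theorem
    rw [Unitary.conjStarAlgAut_apply] at h
    exact h
  · rw [hA.cfc_eq, Matrix.IsHermitian.cfc, Unitary.conjStarAlgAut_apply]
    rfl

/-- The functional calculus may be computed in any orthonormal eigenbasis. -/
theorem cfc_conj_diagonal {U : Matrix (Fin n) (Fin n) ℝ} (hU : U.transpose * U = 1)
    (d : Fin n → ℝ) (f : ℝ → ℝ) :
    cfc f (U * Matrix.diagonal d * U.transpose) =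
      U * Matrix.diagonal (fun i => f (d i)) * U.transpose := by
  have hA : (U * Matrix.diagonal d * U.transpose).IsHermitian := by
    rw [Matrix.IsHermitian, Matrix.conjTranspose_eq_transpose_of_trivial]
    simp [Matrix.mul_assoc]
  obtain ⟨V, m, hV, hAV, hf⟩ := hA.exists_orthogonal_diagonal
  have hU' : U * U.transpose = 1 := mul_eq_one_comm.mp hU
  have hV' : V * V.transpose = 1 := mul_eq_one_comm.mp hV
  -- `W` intertwines the two diagonalizations, so it only couples equal eigenvalues.
  set W := U.transpose * V with hW
  have h1 : Matrix.diagonal d * W = W * Matrix.diagonal m := by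
    calc _ = (U.transpose * U) * Matrix.diagonal d * U.transpose * V := by
          rw [hU, Matrix.one_mul, Matrix.mul_assoc]
      _ = U.transpose * (U * Matrix.diagonal d * U.transpose) * V := by
          simp only [Matrix.mul_assoc]
      _ = U.transpose * V * Matrix.diagonal m * (V.transpose * V) := by
          rw [hAV]; simp only [Matrix.mul_assoc]
      _ = _ := by rw [hV, Matrix.mul_one]
  have h2 : Matrix.diagonal (fun i => f (d i)) * W = W * Matrix.diagonal (fun i => f (m i)) := by
    ext i a
    have h := congrFun (congrFun h1 i) a
    rw [Matrix.diagonal_mul, Matrix.mul_diagonal] at h ⊢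
    by_cases h0 : W i a = 0
    · simp [h0]
    · rw [mul_comm (W i a)] at h
      rw [mul_right_cancel₀ h0 h, mul_comm]
  rw [hf]
  calc _ = (U * U.transpose) * (V * Matrix.diagonal (fun i => f (m i)) * V.transpose) := by
        rw [hU', Matrix.one_mul]
    _ = U * (W * Matrix.diagonal (fun i => f (m i))) * V.transpose := by
        rw [hW]; simp only [Matrix.mul_assoc]
    _ = U * Matrix.diagonal (fun i => f (d i)) * U.transpose * (V * V.transpose) := by
        rw [← h2, hW]; simp only [Matrix.mul_assoc]
    _ = _ := by rw [hV', Matrix.mul_one]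

theorem matPow_conj_diagonal {U : Matrix (Fin n) (Fin n) ℝ} (hU : U.transpose * U = 1)
    (d : Fin n → ℝ) (r : ℝ) :
    matPow (U * Matrix.diagonal d * U.transpose) r =
      U * Matrix.diagonal (fun i => d i ^ r) * U.transpose :=
  cfc_conj_diagonal hU d _

theorem trace_conj_diagonal {U : Matrix (Fin n) (Fin n) ℝ} (hU : U.transpose * U = 1)
    (d : Fin n → ℝ) : (U * Matrix.diagonal d * U.transpose).trace = ∑ i, d i := by
  rw [Matrix.mul_assoc, Matrix.trace_mul_comm, Matrix.mul_assoc, hU, Matrix.mul_one,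
    Matrix.trace_diagonal]

theorem posDef_conj_diagonal_iff {U : Matrix (Fin n) (Fin n) ℝ} (hU : U.transpose * U = 1)
    (d : Fin n → ℝ) : (U * Matrix.diagonal d * U.transpose).PosDef ↔ ∀ i, 0 < d i := by
  have hu : IsUnit U := IsUnit.of_mul_eq_one_right _ hU
  have h := Matrix.IsUnit.posDef_star_right_conjugate_iff (x := Matrix.diagonal d) hu
  rw [Matrix.star_eq_conjTranspose, Matrix.conjTranspose_eq_transpose_of_trivial] at h
  rw [h, Matrix.posDef_diagonal_iff]

end Diagonalization

/-! ### The trace inequality behind `γ`-optimality -/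

/-- Bernoulli's inequality for the exponent `-γ`, in a form that covers both `γ > 0`, where
`t ↦ t ^ (-γ)` is convex, and `-1 < γ < 0`, where it is concave. -/
theorem rpow_neg_tangent_pos {γ : ℝ} (hγ : γ ≠ 0) (hγ' : -1 < γ) {t : ℝ} (ht : 0 < t)
    (ht1 : t ≠ 1) : 0 < (1 / γ) * (t ^ (-γ) - 1) + (t - 1) := by
  -- Both cases are the classical inequality at `1 / t` with exponent `γ + 1`, multiplied by `t`.
  have hs : (1 + (t⁻¹ - 1)) ^ (γ + 1) = t ^ (-γ) * t⁻¹ := by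
    rw [add_sub_cancel, Real.inv_rpow ht.le, ← Real.rpow_neg ht.le, neg_add,
      Real.rpow_add ht, Real.rpow_neg_one]
  have h1 : -1 ≤ t⁻¹ - 1 := by have := inv_pos.mpr ht; linarith
  have h2 : t⁻¹ - 1 ≠ 0 := by rw [sub_ne_zero]; simpa using ht1
  rcases lt_or_gt_of_ne hγ with hneg | hpos
  · have h := rpow_one_add_lt_one_add_mul_self h1 h2 (p := γ + 1) (by linarith) (by linarith)
    rw [hs] at h
    have h := mul_lt_mul_of_pos_right h ht
    rw [inv_mul_cancel_right₀ ht.ne'] at h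
    have h3 : t ^ (-γ) - 1 + γ * (t - 1) < 0 := by
      have : (1 + (γ + 1) * (t⁻¹ - 1)) * t = 1 - γ * (t - 1) := by field_simp; ring
      linarith
    have h4 := mul_pos_of_neg_of_neg (one_div_neg.mpr hneg) h3
    have : 1 / γ * (t ^ (-γ) - 1 + γ * (t - 1)) = (1 / γ) * (t ^ (-γ) - 1) + (t - 1) := by
      field_simp
    linarith
  · have h := one_add_mul_self_lt_rpow_one_add h1 h2 (p := γ + 1) (by linarith)
    rw [hs] at h
    have h := mul_lt_mul_of_pos_right h ht
    rw [inv_mul_cancel_right₀ ht.ne'] at h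
    have h3 : 0 < t ^ (-γ) - 1 + γ * (t - 1) := by
      have : (1 + (γ + 1) * (t⁻¹ - 1)) * t = 1 - γ * (t - 1) := by field_simp; ring
      linarith
    have h4 := mul_pos (one_div_pos.mpr hpos) h3
    have : 1 / γ * (t ^ (-γ) - 1 + γ * (t - 1)) = (1 / γ) * (t ^ (-γ) - 1) + (t - 1) := by
      field_simp
    linarith

/-- The graph of `x ↦ x ^ (-γ) / γ` lies strictly above its tangent line at `y`. -/
theorem rpow_neg_tangent_pos_of_ne {γ : ℝ} (hγ : γ ≠ 0) (hγ' : -1 < γ) {x y : ℝ} (hx : 0 < x)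
    (hy : 0 < y) (hxy : x ≠ y) :
    0 < (1 / γ) * (x ^ (-γ) - y ^ (-γ)) + y ^ (-γ - 1) * (x - y) := by
  have h := rpow_neg_tangent_pos hγ hγ' (div_pos hx hy) (by rwa [Ne, div_eq_one_iff_eq hy.ne'])
  have h := mul_pos (Real.rpow_pos_of_pos hy (-γ)) h
  have hyp := (Real.rpow_pos_of_pos hy (-γ)).ne'
  rw [Real.div_rpow hx.le hy.le] at h
  rw [Real.rpow_sub_one hy.ne']
  refine lt_of_lt_of_eq h ?_
  field_simp

/-- The spectral form of the trace inequality: `w i a` is the squared overlap of the `i`th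
eigenvector of `S` with the `a`th eigenvector of `J`, and `lam`, `μ` are the eigenvalues of `S`
and `J`. -/
theorem doublyStochastic_rpow_inequality {n : ℕ} (hn : 0 < n) {γ : ℝ} (hγ : γ ≠ 0) (hγ' : -1 < γ)
    {lam μ : Fin n → ℝ} (hlam : ∀ i, 0 < lam i) (hμ : ∀ a, 0 < μ a)
    {w : Fin n → Fin n → ℝ} (hw : ∀ i a, 0 ≤ w i a) (hrow : ∀ i, ∑ a, w i a = 1)
    (hcol : ∀ a, ∑ i, w i a = 1) (htr : ∑ i, ∑ a, w i a * ((lam i)⁻¹ * μ a) ≤ 1)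
    {T : ℝ} (hT : T = ∑ i, lam i ^ (-(γ / (γ + 1)))) :
    (1 / γ) * T ^ (γ + 1) ≤ (1 / γ) * ∑ a, μ a ^ (-γ) ∧
      ((1 / γ) * ∑ a, μ a ^ (-γ) = (1 / γ) * T ^ (γ + 1) →
        ∀ i a, w i a ≠ 0 → μ a = T⁻¹ * lam i ^ (1 / (γ + 1))) := by
  have hg : 0 < γ + 1 := by linarith
  have hT0 : 0 < T := by
    have : Nonempty (Fin n) := ⟨⟨0, hn⟩⟩
    rw [hT]
    exact Finset.sum_pos (fun i _ => Real.rpow_pos_of_pos (hlam i) _) Finset.univ_nonempty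
  -- `κ` are the eigenvalues of the optimal information matrix.
  -- They satisfy `κ ^ (-γ - 1) = T ^ (γ + 1) / lam`, so the tangent terms add up to a multiple
  -- of the constraint `htr`.
  set κ : Fin n → ℝ := fun i => T⁻¹ * lam i ^ (1 / (γ + 1)) with hκ
  have hκ0 : ∀ i, 0 < κ i := fun i => mul_pos (inv_pos.mpr hT0) (Real.rpow_pos_of_pos (hlam i) _)
  have hκ1 : ∀ i, κ i ^ (-γ - 1) = T ^ (γ + 1) * (lam i)⁻¹ := by
    intro i
    rw [hκ]
    simp only
    rw [Real.mul_rpow (inv_pos.mpr hT0).le (Real.rpow_pos_of_pos (hlam i) _).le,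
      ← Real.rpow_mul (hlam i).le, Real.inv_rpow hT0.le, ← Real.rpow_neg hT0.le,
      show -(-γ - 1) = γ + 1 by ring, show 1 / (γ + 1) * (-γ - 1) = -1 by field_simp; ring,
      Real.rpow_neg_one]
  have hκ2 : ∀ i, κ i * (lam i)⁻¹ = T⁻¹ * lam i ^ (-(γ / (γ + 1))) := by
    intro i
    rw [hκ]
    simp only
    rw [mul_assoc, ← Real.rpow_neg_one (lam i), ← Real.rpow_add (hlam i)]
    congr 2
    field_simp
    ring
  have hκ3 : ∀ i, κ i ^ (-γ) = T ^ (γ + 1) * (κ i * (lam i)⁻¹) := by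
    intro i
    have := Real.rpow_sub_one (hκ0 i).ne' (-γ)
    rw [eq_div_iff (hκ0 i).ne'] at this
    rw [← this, hκ1]
    ring
  have hκsum : ∑ i, κ i * (lam i)⁻¹ = 1 := by
    simp_rw [hκ2]
    rw [← Finset.mul_sum, ← hT, inv_mul_cancel₀ hT0.ne']
  set g : Fin n → Fin n → ℝ := fun i a =>
    (1 / γ) * (μ a ^ (-γ) - κ i ^ (-γ)) + κ i ^ (-γ - 1) * (μ a - κ i) with hg_def
  have hgpos : ∀ i a, μ a ≠ κ i → 0 < g i a := fun i a h =>
    rpow_neg_tangent_pos_of_ne hγ hγ' (hμ a) (hκ0 i) h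
  have hgnn : ∀ i a, 0 ≤ g i a := by
    intro i a
    by_cases h : μ a = κ i
    · simp [hg_def, h]
    · exact (hgpos i a h).le
  have hsum : ∑ i, ∑ a, w i a * g i a = (1 / γ) * ∑ a, μ a ^ (-γ) - (1 / γ) * T ^ (γ + 1)
      + T ^ (γ + 1) * (∑ i, ∑ a, w i a * ((lam i)⁻¹ * μ a) - 1) := by
    have e1 : ∑ i, ∑ a, w i a * μ a ^ (-γ) = ∑ a, μ a ^ (-γ) := by
      rw [Finset.sum_comm]
      simp_rw [← Finset.sum_mul, hcol, one_mul]
    have e2 : ∑ i, ∑ a, w i a * (κ i * (lam i)⁻¹) = 1 := by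
      simp_rw [← Finset.sum_mul, hrow, one_mul, hκsum]
    have e3 : ∀ i a, w i a * g i a = (1 / γ) * (w i a * μ a ^ (-γ))
        - (1 / γ) * T ^ (γ + 1) * (w i a * (κ i * (lam i)⁻¹))
        + T ^ (γ + 1) * (w i a * ((lam i)⁻¹ * μ a))
        - T ^ (γ + 1) * (w i a * (κ i * (lam i)⁻¹)) := by
      intro i a
      simp only [hg_def]
      rw [hκ3, hκ1]
      ring
    simp_rw [e3, Finset.sum_sub_distrib, Finset.sum_add_distrib, Finset.sum_sub_distrib,
      ← Finset.mul_sum]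
    rw [e1, e2]
    ring
  have hnn : 0 ≤ ∑ i, ∑ a, w i a * g i a :=
    Finset.sum_nonneg fun i _ => Finset.sum_nonneg fun a _ => mul_nonneg (hw i a) (hgnn i a)
  have hTp := Real.rpow_pos_of_pos hT0 (γ + 1)
  have hle : T ^ (γ + 1) * (∑ i, ∑ a, w i a * ((lam i)⁻¹ * μ a) - 1) ≤ 0 :=
    mul_nonpos_of_nonneg_of_nonpos hTp.le (by linarith)
  refine ⟨by linarith, fun heq i a hwi => ?_⟩
  have h0 : ∑ i, ∑ a, w i a * g i a = 0 := by linarith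
  rw [Finset.sum_eq_zero_iff_of_nonneg (fun i _ => Finset.sum_nonneg fun a _ =>
    mul_nonneg (hw i a) (hgnn i a))] at h0
  have h0 := h0 i (Finset.mem_univ _)
  rw [Finset.sum_eq_zero_iff_of_nonneg (fun a _ => mul_nonneg (hw i a) (hgnn i a))] at h0
  have h0 := h0 a (Finset.mem_univ _)
  by_contra hne
  exact (hgpos i a hne).ne' ((mul_eq_zero.mp h0).resolve_left hwi)

section GammaCriterion

variable {n : ℕ} {γ : ℝ} {U : Matrix (Fin n) (Fin n) ℝ} {lam : Fin n → ℝ}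

theorem gammaTrace_conj_diagonal (hU : U.transpose * U = 1) (lam : Fin n → ℝ) (γ : ℝ) :
    gammaTrace γ (U * Matrix.diagonal lam * U.transpose) = ∑ i, lam i ^ (-(γ / (γ + 1))) := by
  rw [gammaTrace, matPow_conj_diagonal hU, trace_conj_diagonal hU]

theorem gammaTrace_pos (hn : 0 < n) (hU : U.transpose * U = 1) (hlam : ∀ i, 0 < lam i) :
    0 < gammaTrace γ (U * Matrix.diagonal lam * U.transpose) := by
  have : Nonempty (Fin n) := ⟨⟨0, hn⟩⟩
  rw [gammaTrace_conj_diagonal hU]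
  exact Finset.sum_pos (fun i _ => Real.rpow_pos_of_pos (hlam i) _) Finset.univ_nonempty

theorem gammaFisher_conj_diagonal (hU : U.transpose * U = 1) (lam : Fin n → ℝ) (γ : ℝ) :
    gammaFisher γ (U * Matrix.diagonal lam * U.transpose) =
      U * Matrix.diagonal (fun i => (gammaTrace γ (U * Matrix.diagonal lam * U.transpose))⁻¹ *
        lam i ^ (1 / (γ + 1))) * U.transpose := by
  rw [gammaFisher, matPow_conj_diagonal hU, one_div]
  have : Matrix.diagonal (fun i => (gammaTrace γ (U * Matrix.diagonal lam * U.transpose))⁻¹ *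
        lam i ^ (1 / (γ + 1))) = (gammaTrace γ (U * Matrix.diagonal lam * U.transpose))⁻¹ •
        Matrix.diagonal (fun i => lam i ^ (1 / (γ + 1))) := by
    rw [← Matrix.diagonal_smul]; rfl
  rw [this, Matrix.mul_smul, Matrix.smul_mul]

theorem gammaFisher_posDef (hn : 0 < n) (hU : U.transpose * U = 1) (hlam : ∀ i, 0 < lam i) :
    (gammaFisher γ (U * Matrix.diagonal lam * U.transpose)).PosDef := by
  rw [gammaFisher_conj_diagonal hU, posDef_conj_diagonal_iff hU]
  exact fun i => mul_pos (inv_pos.mpr (gammaTrace_pos hn hU hlam))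
    (Real.rpow_pos_of_pos (hlam i) _)

theorem gammaMinimum_eq {S : Matrix (Fin n) (Fin n) ℝ} (hT : 0 < gammaTrace γ S) :
    gammaMinimum γ S = ((1 / (n : ℝ)) * gammaTrace γ S ^ (γ + 1)) ^ (1 / γ) := by
  rw [gammaMinimum, Real.mul_rpow (by positivity) (Real.rpow_pos_of_pos hT _).le,
    ← Real.rpow_mul hT.le, Real.div_rpow zero_le_one (Nat.cast_nonneg n), Real.one_rpow,
    mul_one_div]

theorem gammaCriterion_gammaFisher (hn : 0 < n) (hγ' : -1 < γ) (hU : U.transpose * U = 1)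
    (hlam : ∀ i, 0 < lam i) :
    gammaCriterion γ (gammaFisher γ (U * Matrix.diagonal lam * U.transpose)) =
      gammaMinimum γ (U * Matrix.diagonal lam * U.transpose) := by
  have hT := gammaTrace_pos (γ := γ) hn hU hlam
  have hg : γ + 1 ≠ 0 := by linarith
  rw [gammaMinimum_eq hT, gammaCriterion, gammaFisher_conj_diagonal hU,
    matPow_conj_diagonal hU, trace_conj_diagonal hU]
  congr 2
  set T := gammaTrace γ (U * Matrix.diagonal lam * U.transpose) with hTdef
  have h : ∀ i, (T⁻¹ * lam i ^ (1 / (γ + 1))) ^ (-γ) = T ^ γ * lam i ^ (-(γ / (γ + 1))) := by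
    intro i
    rw [Real.mul_rpow (inv_pos.mpr hT).le (Real.rpow_pos_of_pos (hlam i) _).le,
      ← Real.rpow_mul (hlam i).le, Real.inv_rpow hT.le, ← Real.rpow_neg hT.le, neg_neg]
    congr 2
    ring
  simp_rw [h]
  rw [← Finset.mul_sum, ← gammaTrace_conj_diagonal hU, ← hTdef, Real.rpow_add_one hT.ne']

/-- Among positive definite `J` with `Tr (S⁻¹ J) ≤ 1`, the criterion is at least `gammaMinimum γ S`,
and only `gammaFisher γ S` attains this value. -/
theorem gammaMinimum_le_gammaCriterion (hn : 0 < n) (hγ : γ ≠ 0) (hγ' : -1 < γ)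
    (hU : U.transpose * U = 1) (hlam : ∀ i, 0 < lam i) {J : Matrix (Fin n) (Fin n) ℝ}
    (hJ : J.PosDef)
    (htr : (U * Matrix.diagonal (fun i => (lam i)⁻¹) * U.transpose * J).trace ≤ 1) :
    gammaMinimum γ (U * Matrix.diagonal lam * U.transpose) ≤ gammaCriterion γ J ∧
      (gammaCriterion γ J = gammaMinimum γ (U * Matrix.diagonal lam * U.transpose) →
        J = gammaFisher γ (U * Matrix.diagonal lam * U.transpose)) := by
  have hT := gammaTrace_pos (γ := γ) hn hU hlam
  obtain ⟨V, μ, hV, rfl, -⟩ := hJ.1.exists_orthogonal_diagonal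
  have hμ := (posDef_conj_diagonal_iff hV μ).1 hJ
  have hU' : U * U.transpose = 1 := mul_eq_one_comm.mp hU
  have hV' : V * V.transpose = 1 := mul_eq_one_comm.mp hV
  set W := U.transpose * V with hW
  have hW1 : W * W.transpose = 1 := by
    calc _ = U.transpose * (V * V.transpose) * U := by
          rw [hW, Matrix.transpose_mul, Matrix.transpose_transpose]; simp only [Matrix.mul_assoc]
      _ = 1 := by rw [hV', Matrix.mul_one, hU]
  have hW2 : W.transpose * W = 1 := mul_eq_one_comm.mp hW1
  have hrow : ∀ i, ∑ a, W i a ^ 2 = 1 := by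
    intro i
    have h := congrFun (congrFun hW1 i) i
    rw [Matrix.mul_apply, Matrix.one_apply_eq] at h
    simpa [sq] using h
  have hcol : ∀ a, ∑ i, W i a ^ 2 = 1 := by
    intro i
    have h := congrFun (congrFun hW2 i) i
    rw [Matrix.mul_apply, Matrix.one_apply_eq] at h
    simpa [sq] using h
  have htr' : ∑ i, ∑ a, W i a ^ 2 * ((lam i)⁻¹ * μ a) ≤ 1 := by
    refine le_of_eq_of_le ?_ htr
    have e : (U * Matrix.diagonal (fun i => (lam i)⁻¹) * U.transpose *
        (V * Matrix.diagonal μ * V.transpose)).trace =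
        (Matrix.diagonal (fun i => (lam i)⁻¹) * W * (Matrix.diagonal μ * W.transpose)).trace := by
      rw [Matrix.mul_assoc U, Matrix.mul_assoc U, Matrix.trace_mul_comm U, hW,
        Matrix.transpose_mul, Matrix.transpose_transpose]
      simp only [Matrix.mul_assoc]
    rw [e, Matrix.trace]
    refine Finset.sum_congr rfl fun i _ => ?_
    rw [Matrix.diag_apply, Matrix.mul_apply]
    refine Finset.sum_congr rfl fun a _ => ?_
    rw [Matrix.diagonal_mul, Matrix.diagonal_mul, Matrix.transpose_apply]
    ring
  obtain ⟨h1, h2⟩ := doublyStochastic_rpow_inequality hn hγ hγ' hlam hμ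
    (fun i a => sq_nonneg (W i a)) hrow hcol htr' (gammaTrace_conj_diagonal hU lam γ)
  have hn' : (0 : ℝ) < 1 / n := by positivity
  have hJtr : gammaCriterion γ (V * Matrix.diagonal μ * V.transpose) =
      ((1 / (n : ℝ)) * ∑ a, μ a ^ (-γ)) ^ (1 / γ) := by
    rw [gammaCriterion, matPow_conj_diagonal hV, trace_conj_diagonal hV]
  have hX : 0 < ∑ a, μ a ^ (-γ) := by
    have : Nonempty (Fin n) := ⟨⟨0, hn⟩⟩
    exact Finset.sum_pos (fun i _ => Real.rpow_pos_of_pos (hμ i) _) Finset.univ_nonempty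
  rw [gammaMinimum_eq hT, hJtr]
  set T := gammaTrace γ (U * Matrix.diagonal lam * U.transpose) with hTdef
  have hY := Real.rpow_pos_of_pos hT (γ + 1)
  refine ⟨?_, fun heq => ?_⟩
  · rcases lt_or_gt_of_ne hγ with hneg | hpos
    · have h3 := (mul_le_mul_left_of_neg (one_div_neg.mpr hneg)).1 h1
      exact Real.rpow_le_rpow_of_nonpos (mul_pos hn' hX)
        (mul_le_mul_of_nonneg_left h3 hn'.le) (one_div_neg.mpr hneg).le
    · have h3 := (mul_le_mul_iff_right₀ (one_div_pos.mpr hpos)).1 h1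
      exact Real.rpow_le_rpow (mul_pos hn' hY).le
        (mul_le_mul_of_nonneg_left h3 hn'.le) (one_div_pos.mpr hpos).le
  · have h3 := (Real.rpow_left_inj (mul_pos hn' hX).le (mul_pos hn' hY).le
      (one_div_ne_zero hγ)).1 heq
    have h4 := mul_left_cancel₀ hn'.ne' h3
    have h5 := h2 (by rw [h4])
    rw [gammaFisher_conj_diagonal hU, ← hTdef]
    have h6 : W * Matrix.diagonal μ =
        Matrix.diagonal (fun i => T⁻¹ * lam i ^ (1 / (γ + 1))) * W := by
      ext i a
      rw [Matrix.mul_diagonal, Matrix.diagonal_mul, mul_comm]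
      by_cases h0 : W i a = 0
      · simp [h0]
      · rw [h5 i a (pow_ne_zero 2 h0)]
    calc _ = (U * U.transpose) * (V * Matrix.diagonal μ * V.transpose) := by
          rw [hU', Matrix.one_mul]
      _ = U * (W * Matrix.diagonal μ) * V.transpose := by
          rw [hW]; simp only [Matrix.mul_assoc]
      _ = U * Matrix.diagonal (fun i => T⁻¹ * lam i ^ (1 / (γ + 1))) * U.transpose *
          (V * V.transpose) := by
          rw [h6, hW]; simp only [Matrix.mul_assoc]
      _ = _ := by rw [hV', Matrix.mul_one]

end GammaCriterion

/-! ### The symmetrized inner product of a state -/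

section SymInner

/-- The real symmetric bilinear form `⟨A, B⟩ = Re Tr (ρ (A B + B A)) / 2` on operators. -/
def symInner (ρ : Matrix (Fin 2) (Fin 2) ℂ) :
    Matrix (Fin 2) (Fin 2) ℂ →ₗ[ℝ] Matrix (Fin 2) (Fin 2) ℂ →ₗ[ℝ] ℝ :=
  LinearMap.mk₂ ℝ (fun A B => (ρ * (A * B + B * A)).trace.re / 2)
    (fun A A' B => by
      simp only [Matrix.mul_add, Matrix.add_mul, Matrix.trace_add, Complex.add_re]; ring)
    (fun c A B => by
      simp only [Matrix.mul_smul, Matrix.smul_mul, ← smul_add, Matrix.trace_smul,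
        Complex.smul_re, smul_eq_mul]; ring)
    (fun A B B' => by
      simp only [Matrix.mul_add, Matrix.add_mul, Matrix.trace_add, Complex.add_re]; ring)
    (fun c A B => by
      simp only [Matrix.mul_smul, Matrix.smul_mul, ← smul_add, Matrix.trace_smul,
        Complex.smul_re, smul_eq_mul]; ring)

variable {ρ A B : Matrix (Fin 2) (Fin 2) ℂ}

theorem symInner_apply (ρ A B : Matrix (Fin 2) (Fin 2) ℂ) :
    symInner ρ A B = (ρ * (A * B + B * A)).trace.re / 2 := rfl

theorem symInner_comm (ρ A B : Matrix (Fin 2) (Fin 2) ℂ) :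
    symInner ρ A B = symInner ρ B A := by
  rw [symInner_apply, symInner_apply, add_comm]

theorem symInner_self (ρ A : Matrix (Fin 2) (Fin 2) ℂ) :
    symInner ρ A A = (ρ * (A * A)).trace.re := by
  rw [symInner_apply, Matrix.mul_add, Matrix.trace_add, Complex.add_re]; ring

theorem symInner_one_right (ρ A : Matrix (Fin 2) (Fin 2) ℂ) :
    symInner ρ A 1 = (ρ * A).trace.re := by
  rw [symInner_apply, Matrix.mul_one, Matrix.one_mul, Matrix.mul_add, Matrix.trace_add,
    Complex.add_re]; ring

theorem symInner_self_nonneg (hρ : ρ.PosSemidef) (hA : A.IsHermitian) : 0 ≤ symInner ρ A A := by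
  have h := (hρ.conjTranspose_mul_mul_same A).trace_nonneg
  rw [hA.eq, Matrix.mul_assoc, Matrix.trace_mul_comm, Matrix.mul_assoc] at h
  rw [symInner_self]
  exact (Complex.nonneg_iff.1 h).1

open scoped MatrixOrder in
theorem trace_mul_re_nonneg (hρ : ρ.PosSemidef) (hA : A.PosSemidef) :
    0 ≤ (ρ * A).trace.re := by
  obtain ⟨C, rfl⟩ := CStarAlgebra.nonneg_iff_eq_star_mul_self.1 hA.nonneg
  have h := (hρ.mul_mul_conjTranspose_same C).trace_nonneg
  rw [Matrix.mul_assoc, Matrix.trace_mul_comm, Matrix.mul_assoc] at h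
  rw [Matrix.star_eq_conjTranspose]
  exact (Complex.nonneg_iff.1 h).1

/-- For a positive semidefinite `2 × 2` matrix, `A² ≤ Tr(A) A` by the
Cayley–Hamilton theorem and `det A ≥ 0`. -/
theorem symInner_self_le_trace_mul (hρ1 : ρ.trace = 1) (hA : A.PosSemidef) :
    symInner ρ A A ≤ A.trace.re * (ρ * A).trace.re := by
  have hCH : A * A = A.trace • A - A.det • (1 : Matrix (Fin 2) (Fin 2) ℂ) := by
    ext i j
    fin_cases i <;> fin_cases j <;>
      simp [Matrix.mul_apply, Matrix.trace_fin_two, Matrix.det_fin_two, Fin.sum_univ_two] <;> ring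
  have ht := Complex.nonneg_iff.1 hA.trace_nonneg
  have hd := Complex.nonneg_iff.1 hA.det_nonneg
  rw [symInner_self, hCH, Matrix.mul_sub, Matrix.trace_sub, Matrix.mul_smul, Matrix.mul_smul,
    Matrix.trace_smul, Matrix.trace_smul, Matrix.mul_one, hρ1, smul_eq_mul, smul_eq_mul, mul_one,
    Complex.sub_re, Complex.mul_re, ← ht.2]
  linarith [hd.1]

theorem isHermitian_sum_smul {ι : Type*} [Fintype ι] {N : ι → Matrix (Fin 2) (Fin 2) ℂ}
    (hN : ∀ k, (N k).IsHermitian) (c : ι → ℝ) : (∑ k, c k • N k).IsHermitian := by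
  rw [Matrix.IsHermitian, Matrix.conjTranspose_sum]
  refine Finset.sum_congr rfl fun k _ => ?_
  rw [Matrix.conjTranspose_smul, (hN k).eq, star_trivial]

/-- Bessel's inequality for an orthonormal family of observables of mean zero, together with `1`. -/
theorem symInner_bessel {ι : Type*} [Fintype ι] [DecidableEq ι] (hρ : ρ.PosSemidef)
    (hρ1 : ρ.trace = 1) {N : ι → Matrix (Fin 2) (Fin 2) ℂ} (hN : ∀ k, (N k).IsHermitian)
    (hN1 : ∀ k, symInner ρ (N k) 1 = 0)
    (hNN : ∀ k l, symInner ρ (N k) (N l) = if k = l then 1 else 0) (hA : A.IsHermitian) :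
    (ρ * A).trace.re ^ 2 + ∑ k, symInner ρ (N k) A ^ 2 ≤ symInner ρ A A := by
  set p := (ρ * A).trace.re with hp
  set Y := ∑ k, symInner ρ (N k) A • N k with hY
  have h11 : symInner ρ 1 1 = 1 := by rw [symInner_one_right, Matrix.mul_one, hρ1, Complex.one_re]
  have hA1 : symInner ρ A 1 = p := symInner_one_right ρ A
  have hX : (A - p • (1 : Matrix (Fin 2) (Fin 2) ℂ) - Y).IsHermitian := by
    refine (hA.sub ?_).sub (isHermitian_sum_smul hN _)
    rw [Matrix.IsHermitian, Matrix.conjTranspose_smul, Matrix.conjTranspose_one, star_trivial]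
  have hYB : ∀ B, symInner ρ Y B = ∑ k, symInner ρ (N k) A * symInner ρ (N k) B := by
    intro B
    simp [hY, map_sum, LinearMap.sum_apply]
  have hY1 : symInner ρ Y 1 = 0 := by rw [hYB]; simp [hN1]
  have hYA : symInner ρ Y A = ∑ k, symInner ρ (N k) A ^ 2 := by
    rw [hYB]; exact Finset.sum_congr rfl fun k _ => (sq _).symm
  have hYN : ∀ l, symInner ρ (N l) Y = symInner ρ (N l) A := by
    intro l
    rw [symInner_comm, hYB]
    simp [hNN]
  have hYY : symInner ρ Y Y = ∑ k, symInner ρ (N k) A ^ 2 := by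
    rw [hYB]; exact Finset.sum_congr rfl fun k _ => by rw [hYN, sq]
  have h := symInner_self_nonneg hρ hX
  simp only [map_sub, LinearMap.sub_apply, map_smul, LinearMap.smul_apply, smul_eq_mul] at h
  rw [symInner_comm ρ 1 A, symInner_comm ρ A Y, symInner_comm ρ 1 Y, h11, hA1, hY1, hYA, hYY] at h
  nlinarith

end SymInner

/-! ### Information matrices of measurements -/

section Information

variable {ι : Type*} {ρ : Matrix (Fin 2) (Fin 2) ℂ}

/-- The matrix `∑ₓ ⟨N_k, Pₓ⟩ ⟨N_l, Pₓ⟩ / Tr (ρ Pₓ)`. It is the Fisher information matrix of the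
measurement `P` when the `N_k` are SLD operators; outcomes of probability zero contribute `0`. -/
def infoMatrix (ρ : Matrix (Fin 2) (Fin 2) ℂ) (N : ι → Matrix (Fin 2) (Fin 2) ℂ)
    (P : Measurement) : Matrix ι ι ℝ :=
  Matrix.of fun k l => ∑ x, ((ρ * P.2.elem x).trace.re)⁻¹ *
    (symInner ρ (N k) (P.2.elem x) * symInner ρ (N l) (P.2.elem x))

theorem infoMatrix_apply_self_nonneg (hρ : ρ.PosSemidef) (N : ι → Matrix (Fin 2) (Fin 2) ℂ)
    (P : Measurement) (k : ι) : 0 ≤ infoMatrix ρ N P k k := by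
  rw [infoMatrix, Matrix.of_apply]
  exact Finset.sum_nonneg fun x _ => mul_nonneg
    (inv_nonneg.2 (trace_mul_re_nonneg hρ (P.2.posSemidef x))) (mul_self_nonneg _)

variable [Fintype ι]

/-- A change of the operators `N` is a congruence of the information matrix. -/
theorem infoMatrix_congruence {κ : Type*} [Fintype κ] (B : Matrix κ ι ℝ)
    (N : ι → Matrix (Fin 2) (Fin 2) ℂ) (P : Measurement) :
    infoMatrix ρ (fun k => ∑ j, B k j • N j) P = B * infoMatrix ρ N P * B.transpose := by
  ext k l
  simp only [infoMatrix, Matrix.of_apply, Matrix.mul_apply, Matrix.transpose_apply, map_sum,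
    map_smul, LinearMap.sum_apply, LinearMap.smul_apply, smul_eq_mul, Finset.sum_mul,
    Finset.mul_sum]
  rw [Finset.sum_comm]
  refine Finset.sum_congr rfl fun j _ => ?_
  rw [Finset.sum_comm]
  refine Finset.sum_congr rfl fun i _ => Finset.sum_congr rfl fun x _ => ?_
  ring

/-- The information bound: with respect to an orthonormal family of mean-zero observables, the
information matrix of any qubit measurement has trace at most `1`. -/
theorem trace_infoMatrix_le_one [DecidableEq ι] (hρ : ρ.PosSemidef) (hρ1 : ρ.trace = 1)
    {N : ι → Matrix (Fin 2) (Fin 2) ℂ} (hN : ∀ k, (N k).IsHermitian)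
    (hN1 : ∀ k, symInner ρ (N k) 1 = 0)
    (hNN : ∀ k l, symInner ρ (N k) (N l) = if k = l then 1 else 0) (P : Measurement) :
    (infoMatrix ρ N P).trace ≤ 1 := by
  have hx : ∀ x, ((ρ * P.2.elem x).trace.re)⁻¹ * ∑ k, symInner ρ (N k) (P.2.elem x) ^ 2 ≤
      (P.2.elem x).trace.re - (ρ * P.2.elem x).trace.re := by
    intro x
    have hP := P.2.posSemidef x
    have h1 := symInner_bessel hρ hρ1 hN hN1 hNN hP.1
    have h2 := symInner_self_le_trace_mul hρ1 hP
    have h3 := trace_mul_re_nonneg hρ hP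
    -- At probability zero the left side is `0` by convention.
    rcases h3.eq_or_lt with h0 | h0
    · rw [← h0]
      simpa using (Complex.nonneg_iff.1 hP.trace_nonneg).1
    · rw [inv_mul_le_iff₀ h0]
      nlinarith
  have hsum1 : ∑ x, (P.2.elem x).trace.re = 2 := by
    rw [← Complex.re_sum, ← Matrix.trace_sum, P.2.sum_eq_one]
    simp [Matrix.trace_one]
  have hsum2 : ∑ x, (ρ * P.2.elem x).trace.re = 1 := by
    rw [← Complex.re_sum, ← Matrix.trace_sum, ← Finset.mul_sum, P.2.sum_eq_one, Matrix.mul_one,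
      hρ1, Complex.one_re]
  calc (infoMatrix ρ N P).trace
      = ∑ x, ((ρ * P.2.elem x).trace.re)⁻¹ * ∑ k, symInner ρ (N k) (P.2.elem x) ^ 2 := by
        simp only [Matrix.trace, Matrix.diag_apply, infoMatrix, Matrix.of_apply, ← sq,
          Finset.mul_sum]
        rw [Finset.sum_comm]
    _ ≤ ∑ x, ((P.2.elem x).trace.re - (ρ * P.2.elem x).trace.re) :=
        Finset.sum_le_sum fun x _ => hx x
    _ = 1 := by rw [Finset.sum_sub_distrib, hsum1, hsum2]; norm_num

theorem abs_infoMatrix_apply_le_trace (hρ : ρ.PosSemidef) (N : ι → Matrix (Fin 2) (Fin 2) ℂ)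
    (P : Measurement) (k l : ι) : |infoMatrix ρ N P k l| ≤ (infoMatrix ρ N P).trace := by
  have hkk : ∀ k, infoMatrix ρ N P k k ≤ (infoMatrix ρ N P).trace := fun k =>
    Finset.single_le_sum (f := fun k => infoMatrix ρ N P k k)
      (fun i _ => infoMatrix_apply_self_nonneg hρ N P i) (Finset.mem_univ k)
  have h : |infoMatrix ρ N P k l| ≤ (infoMatrix ρ N P k k + infoMatrix ρ N P l l) / 2 := by
    simp only [infoMatrix, Matrix.of_apply]
    refine (Finset.abs_sum_le_sum_abs _ _).trans ?_
    rw [← Finset.sum_add_distrib, Finset.sum_div]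
    refine Finset.sum_le_sum fun x _ => ?_
    have h3 := inv_nonneg.2 (trace_mul_re_nonneg hρ (P.2.posSemidef x))
    rw [abs_mul, abs_of_nonneg h3, ← mul_add, mul_div_assoc]
    refine mul_le_mul_of_nonneg_left ?_ h3
    rw [abs_mul]
    nlinarith [sq_nonneg (|symInner ρ (N k) (P.2.elem x)| - |symInner ρ (N l) (P.2.elem x)|),
      abs_mul_abs_self (symInner ρ (N k) (P.2.elem x)),
      abs_mul_abs_self (symInner ρ (N l) (P.2.elem x))]
  linarith [hkk k, hkk l]

/-- Measuring the observable `N i` exhausts the information bound in the direction `i`, which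
leaves no information on the other directions. -/
theorem infoMatrix_of_isProjectiveFor [DecidableEq ι] (hρ : ρ.PosSemidef) (hρ1 : ρ.trace = 1)
    {N : ι → Matrix (Fin 2) (Fin 2) ℂ} (hN : ∀ k, (N k).IsHermitian)
    (hN1 : ∀ k, symInner ρ (N k) 1 = 0)
    (hNN : ∀ k l, symInner ρ (N k) (N l) = if k = l then 1 else 0) {P : Measurement} {i : ι}
    (hP : P.IsProjectiveFor (N i)) :
    infoMatrix ρ N P = Matrix.diagonal (Pi.single i 1) := by
  obtain ⟨hproj, a, -, ha⟩ := hP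
  have ha' : N i = ∑ x, a x • P.2.elem x := by
    rw [ha]; exact Finset.sum_congr rfl fun x _ => Complex.coe_smul _ _
  have h1 : ∀ x, symInner ρ (N i) (P.2.elem x) = a x * (ρ * P.2.elem x).trace.re := by
    intro x
    rw [ha', map_sum, LinearMap.sum_apply, Finset.sum_eq_single x]
    · rw [map_smul, LinearMap.smul_apply, smul_eq_mul, symInner_self, hproj, if_pos rfl]
    · intro y _ hy
      rw [map_smul, LinearMap.smul_apply, symInner_apply, hproj, hproj, if_neg hy,
        if_neg hy.symm]
      simp
    · simp
  have hii : infoMatrix ρ N P i i = 1 := by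
    have h := hNN i i
    rw [if_pos rfl] at h
    rw [← h]
    have hself : symInner ρ (N i) (N i) = ∑ x, symInner ρ (N i) (a x • P.2.elem x) := by
      rw [← map_sum, ← ha']
    rw [hself, infoMatrix, Matrix.of_apply]
    refine Finset.sum_congr rfl fun x _ => ?_
    rw [map_smul, smul_eq_mul, h1]
    by_cases h0 : (ρ * P.2.elem x).trace.re = 0
    · simp [h0]
    · field_simp
  have htr := trace_infoMatrix_le_one hρ hρ1 hN hN1 hNN P
  have hkk : ∀ k, k ≠ i → infoMatrix ρ N P k k = 0 := by
    intro k hk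
    have hnn := infoMatrix_apply_self_nonneg hρ N P
    have h2 := Finset.sum_le_sum_of_subset_of_nonneg (Finset.subset_univ {k, i})
      (f := fun k => infoMatrix ρ N P k k) (fun j _ _ => hnn j)
    rw [Finset.sum_pair hk, hii] at h2
    have h3 : infoMatrix ρ N P k k + 1 ≤ 1 := h2.trans htr
    linarith [hnn k]
  have hterm : ∀ k, k ≠ i → ∀ x, ((ρ * P.2.elem x).trace.re)⁻¹ = 0 ∨
      symInner ρ (N k) (P.2.elem x) = 0 := by
    intro k hk x
    have h := hkk k hk
    simp only [infoMatrix, Matrix.of_apply] at h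
    rw [Finset.sum_eq_zero_iff_of_nonneg fun x _ => mul_nonneg
      (inv_nonneg.2 (trace_mul_re_nonneg hρ (P.2.posSemidef x))) (mul_self_nonneg _)] at h
    rcases mul_eq_zero.1 (h x (Finset.mem_univ x)) with h | h
    · exact Or.inl h
    · exact Or.inr (mul_self_eq_zero.1 h)
  ext k l
  by_cases hk : k = i
  · by_cases hl : l = i
    · rw [hk, hl, hii, Matrix.diagonal_apply_eq, Pi.single_eq_same]
    · rw [Matrix.diagonal_apply_ne _ (by rw [hk]; exact Ne.symm hl)]
      rw [infoMatrix, Matrix.of_apply]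
      refine Finset.sum_eq_zero fun x _ => ?_
      rcases hterm l hl x with h | h <;> simp [h]
  · have : Matrix.diagonal (Pi.single i (1 : ℝ)) k l = 0 := by
      rw [Matrix.diagonal_apply, Pi.single_eq_of_ne hk, ite_self]
    rw [this, infoMatrix, Matrix.of_apply]
    refine Finset.sum_eq_zero fun x _ => ?_
    rcases hterm k hk x with h | h <;> simp [h]

/-- Every qubit observable has a projective measurement. -/
theorem Matrix.IsHermitian.exists_isProjectiveFor {A : Matrix (Fin 2) (Fin 2) ℂ}
    (hA : A.IsHermitian) : ∃ P : Measurement, P.IsProjectiveFor A := by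
  set U : Matrix (Fin 2) (Fin 2) ℂ := (hA.eigenvectorUnitary).1 with hU
  have hU1 : U.conjTranspose * U = 1 := Unitary.coe_star_mul_self hA.eigenvectorUnitary
  have hU2 : U * U.conjTranspose = 1 := Unitary.coe_mul_star_self hA.eigenvectorUnitary
  have hsp : A = U * Matrix.diagonal (fun i => (hA.eigenvalues i : ℂ)) * U.conjTranspose := by
    have h := hA.spectral_theorem
    rw [Unitary.conjStarAlgAut_apply] at h
    exact h
  by_cases hne : hA.eigenvalues 0 = hA.eigenvalues 1
  · have hA1 : A = (hA.eigenvalues 0 : ℂ) • (1 : Matrix (Fin 2) (Fin 2) ℂ) := by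
      have hd : Matrix.diagonal (fun i => (hA.eigenvalues i : ℂ)) =
          (hA.eigenvalues 0 : ℂ) • (1 : Matrix (Fin 2) (Fin 2) ℂ) := by
        ext i j
        fin_cases i <;> fin_cases j <;> simp [hne]
      conv_lhs => rw [hsp, hd, Matrix.mul_smul, Matrix.mul_one, Matrix.smul_mul, hU2]
    -- A multiple of the identity is measured by the trivial POVM with a single outcome.
    refine ⟨⟨1, ⟨fun _ => 1, fun _ => Matrix.PosSemidef.one, by simp⟩⟩, ?_, ?_⟩
    · intro x y
      simp [Subsingleton.elim x y]
    · exact ⟨fun _ => hA.eigenvalues 0, Function.injective_of_subsingleton _, by simpa using hA1⟩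
  · set E : Fin 2 → Matrix (Fin 2) (Fin 2) ℂ :=
      fun x => U * Matrix.diagonal (Pi.single x 1) * U.conjTranspose with hE
    have hpos : ∀ x, (E x).PosSemidef := fun x =>
      (Matrix.PosSemidef.diagonal (Pi.single_nonneg.2 zero_le_one)).mul_mul_conjTranspose_same U
    have hsum : ∀ c : Fin 2 → ℂ, ∑ x, c x • E x = U * Matrix.diagonal c * U.conjTranspose := by
      intro c
      have hc : Matrix.diagonal c = ∑ x, c x • Matrix.diagonal (Pi.single x (1 : ℂ)) := by
        ext i j
        rw [Fin.sum_univ_two]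
        fin_cases i <;> fin_cases j <;> simp
      rw [hc, Matrix.mul_sum, Matrix.sum_mul]
      refine Finset.sum_congr rfl fun x _ => ?_
      rw [Matrix.mul_smul, Matrix.smul_mul]
    have hmul : ∀ x y, E x * E y = if x = y then E x else 0 := by
      intro x y
      have e : E x * E y = U * (Matrix.diagonal (Pi.single x 1) * (U.conjTranspose * U) *
          Matrix.diagonal (Pi.single y 1)) * U.conjTranspose := by
        simp only [hE, Matrix.mul_assoc]
      rw [e, hU1, Matrix.mul_one, Matrix.diagonal_mul_diagonal]
      split_ifs with hxy
      · subst hxy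
        simp only [hE]
        congr 3
        ext i
        by_cases h : i = x <;> simp [h]
      · have : (fun i => (Pi.single x 1 : Fin 2 → ℂ) i * (Pi.single y 1 : Fin 2 → ℂ) i) = 0 := by
          ext i
          by_cases h : i = x
          · subst h; simp [hxy]
          · simp [h]
        rw [this]
        simp
    refine ⟨⟨2, ⟨E, hpos, ?_⟩⟩, hmul, hA.eigenvalues, ?_, ?_⟩
    · have h := hsum 1
      simp only [Pi.one_apply, one_smul, Matrix.diagonal_one', Matrix.mul_one, hU2] at h
      exact h
    · intro x y hxy
      fin_cases x <;> fin_cases y <;>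
        first | rfl | exact absurd hxy hne | exact absurd hxy.symm hne
    · exact hsp.trans (hsum _).symm

end Information

/-! ### Fisher information of a qubit model -/

namespace QubitModel

variable {n : ℕ} (M : QubitModel n) {θ : EuclideanSpace ℝ (Fin n)}

theorem differentiableAt_entry (hθ : θ ∈ M.Θ) (a b : Fin 2) :
    DifferentiableAt ℝ (fun t => M.ρ t a b) θ :=
  ((M.smooth a b).contDiffAt (M.isOpen.mem_nhds hθ)).differentiableAt (by simp)

theorem hasFDerivAt_trace_mul_re (hθ : θ ∈ M.Θ) (X : Matrix (Fin 2) (Fin 2) ℂ) :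
    HasFDerivAt (fun t => (M.ρ t * X).trace.re)
      (∑ a, ∑ b, Complex.reCLM.comp (X b a • fderiv ℝ (fun t => M.ρ t a b) θ)) θ := by
  have e : (fun t => (M.ρ t * X).trace.re) = fun t => ∑ a, ∑ b, (M.ρ t a b * X b a).re := by
    funext t
    simp only [Matrix.trace, Matrix.diag_apply, Matrix.mul_apply, Complex.re_sum]
  rw [e]
  refine HasFDerivAt.fun_sum fun a _ => HasFDerivAt.fun_sum fun b _ => ?_
  exact Complex.reCLM.hasFDerivAt.comp θ
    ((M.differentiableAt_entry hθ a b).hasFDerivAt.mul_const (X b a))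

theorem partialDeriv_trace_mul_re (hθ : θ ∈ M.Θ) (X : Matrix (Fin 2) (Fin 2) ℂ) (i : Fin n) :
    partialDeriv i (fun t => (M.ρ t * X).trace.re) θ = (M.stateDeriv θ i * X).trace.re := by
  rw [partialDeriv, (M.hasFDerivAt_trace_mul_re hθ X).fderiv]
  simp only [Matrix.trace, Matrix.diag_apply, Matrix.mul_apply, Complex.re_sum,
    sum_apply, ContinuousLinearMap.comp_apply, smul_apply,
    Complex.reCLM_apply, stateDeriv, Matrix.of_apply, partialDeriv, smul_eq_mul]
  refine Finset.sum_congr rfl fun a _ => Finset.sum_congr rfl fun b _ => ?_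
  rw [mul_comm]

theorem IsSLD.trace_stateDeriv_mul_re {M : QubitModel n} {i : Fin n}
    {L : Matrix (Fin 2) (Fin 2) ℂ} (hL : M.IsSLD θ i L) (X : Matrix (Fin 2) (Fin 2) ℂ) :
    (M.stateDeriv θ i * X).trace.re = symInner (M.ρ θ) L X := by
  have h : (M.stateDeriv θ i * X).trace = (1 / 2 : ℂ) * (M.ρ θ * (L * X + X * L)).trace := by
    rw [hL.2, Matrix.smul_mul, Matrix.trace_smul, smul_eq_mul, Matrix.add_mul, Matrix.mul_add,
      Matrix.trace_add, Matrix.trace_add, Matrix.mul_assoc, Matrix.mul_assoc L,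
      Matrix.trace_mul_comm L, Matrix.mul_assoc (M.ρ θ)]
  rw [h, symInner_apply, show (1 / 2 : ℂ) = ((1 / 2 : ℝ) : ℂ) by norm_num, Complex.re_ofReal_mul]
  ring

/-- An SLD operator has mean zero, because the trace of the state is constant. -/
theorem IsSLD.symInner_one {M : QubitModel n} {i : Fin n} {L : Matrix (Fin 2) (Fin 2) ℂ}
    (hθ : θ ∈ M.Θ) (hL : M.IsSLD θ i L) : symInner (M.ρ θ) L 1 = 0 := by
  rw [← hL.trace_stateDeriv_mul_re, ← M.partialDeriv_trace_mul_re hθ, partialDeriv]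
  have h : (fun t => (M.ρ t * 1).trace.re) =ᶠ[nhds θ] fun _ => (1 : ℝ) := by
    filter_upwards [M.isOpen.mem_nhds hθ] with t ht
    rw [Matrix.mul_one, M.trace_eq_one t ht, Complex.one_re]
  rw [h.fderiv_eq]
  simp

/-- The Fisher information without logarithms. The inverse of `0` is `0`, so outcomes of probability
zero contribute nothing on either side. -/
theorem fisher_apply (hθ : θ ∈ M.Θ) (P : Measurement) (i j : Fin n) :
    M.fisher θ P i j = ∑ x, ((M.ρ θ * P.2.elem x).trace.re)⁻¹ *
      ((M.stateDeriv θ i * P.2.elem x).trace.re * (M.stateDeriv θ j * P.2.elem x).trace.re) := by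
  rw [fisher, Matrix.of_apply]
  refine Finset.sum_congr rfl fun x _ => ?_
  by_cases h0 : M.prob P x θ = 0
  · have h0' : (M.ρ θ * P.2.elem x).trace.re = 0 := h0
    rw [h0, h0']
    simp
  · have hlog : ∀ i, partialDeriv i (fun t => Real.log (M.prob P x t)) θ =
        (M.prob P x θ)⁻¹ * (M.stateDeriv θ i * P.2.elem x).trace.re := by
      intro i
      rw [← M.partialDeriv_trace_mul_re hθ, partialDeriv, partialDeriv,
        fderiv.log (f := M.prob P x)
          (M.hasFDerivAt_trace_mul_re hθ (P.2.elem x)).differentiableAt h0]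
      rfl
    rw [hlog, hlog]
    change M.prob P x θ * _ = (M.prob P x θ)⁻¹ * _
    field_simp

theorem fisher_eq_infoMatrix (hθ : θ ∈ M.Θ) {L : Fin n → Matrix (Fin 2) (Fin 2) ℂ}
    (hL : ∀ i, M.IsSLD θ i (L i)) (P : Measurement) :
    M.fisher θ P = infoMatrix (M.ρ θ) L P := by
  ext i j
  rw [M.fisher_apply hθ, infoMatrix, Matrix.of_apply]
  simp only [(hL _).trace_stateDeriv_mul_re]

theorem measurable_fisher (hθ : θ ∈ M.Θ) (i j : Fin n) :
    Measurable fun P : Measurement => M.fisher θ P i j := by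
  -- A map out of the disjoint union over the numbers of outcomes is measurable on each part.
  have key : ∀ k, Measurable fun Q : POVM k => M.fisher θ ⟨k, Q⟩ i j := by
    intro k
    have hentry : ∀ (x : Fin k) (a b : Fin 2), Measurable fun Q : POVM k => Q.elem x a b := by
      intro x a b
      have h : Measurable fun Q : POVM k => fun (x : Fin k) (a b : Fin 2) => Q.elem x a b :=
        comap_measurable _
      exact (measurable_pi_apply b).comp ((measurable_pi_apply a).comp
        ((measurable_pi_apply x).comp h))
    have htr : ∀ (X : Matrix (Fin 2) (Fin 2) ℂ) (x : Fin k),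
        Measurable fun Q : POVM k => (X * Q.elem x).trace.re := by
      intro X x
      simp only [Matrix.trace, Matrix.diag_apply, Matrix.mul_apply]
      exact Complex.measurable_re.comp (Finset.measurable_fun_sum _ fun a _ =>
        Finset.measurable_fun_sum _ fun b _ => (hentry x b a).const_mul _)
    have hsum : (fun Q : POVM k => M.fisher θ ⟨k, Q⟩ i j) = fun Q => ∑ x : Fin k,
        ((M.ρ θ * Q.elem x).trace.re)⁻¹ * ((M.stateDeriv θ i * Q.elem x).trace.re *
          (M.stateDeriv θ j * Q.elem x).trace.re) :=
      funext fun Q => M.fisher_apply hθ ⟨k, Q⟩ i j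
    rw [hsum]
    exact Finset.measurable_fun_sum _ fun x _ => (htr (M.ρ θ) x).inv.mul
      ((htr (M.stateDeriv θ i) x).mul (htr (M.stateDeriv θ j) x))
  intro s hs
  exact MeasurableSpace.measurableSet_iInf.2 fun k => key k hs

end QubitModel

/-! ### Information bound in the SLD eigenbasis -/

namespace QubitModel

variable {n : ℕ} {M : QubitModel n} {θ : EuclideanSpace ℝ (Fin n)}
  {L : Fin n → Matrix (Fin 2) (Fin 2) ℂ} {U : Matrix (Fin n) (Fin n) ℝ} {lam : Fin n → ℝ}

/-- The matrix `diag(lam)^{-1/2} Uᵀ`, which whitens `U diag(lam) Uᵀ`. -/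
def whitening (U : Matrix (Fin n) (Fin n) ℝ) (lam : Fin n → ℝ) : Matrix (Fin n) (Fin n) ℝ :=
  Matrix.diagonal (fun i => (Real.sqrt (lam i))⁻¹) * U.transpose

/-- The inverse `U diag(lam)^{1/2}` of `whitening U lam`. -/
def coloring (U : Matrix (Fin n) (Fin n) ℝ) (lam : Fin n → ℝ) : Matrix (Fin n) (Fin n) ℝ :=
  U * Matrix.diagonal (fun i => Real.sqrt (lam i))

theorem coloring_mul_whitening (hU : U.transpose * U = 1) (hlam : ∀ i, 0 < lam i) :
    coloring U lam * whitening U lam = 1 := by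
  rw [coloring, whitening, Matrix.mul_assoc, ← Matrix.mul_assoc (Matrix.diagonal _),
    Matrix.diagonal_mul_diagonal]
  have : (fun i => Real.sqrt (lam i) * (Real.sqrt (lam i))⁻¹) = 1 := by
    funext i
    exact mul_inv_cancel₀ (Real.sqrt_pos.2 (hlam i)).ne'
  rw [this, Matrix.diagonal_one', Matrix.one_mul]
  exact mul_eq_one_comm.mp hU

theorem whitening_transpose_mul (hlam : ∀ i, 0 < lam i) :
    (whitening U lam).transpose * whitening U lam =
      U * Matrix.diagonal (fun i => (lam i)⁻¹) * U.transpose := by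
  rw [whitening, Matrix.transpose_mul, Matrix.transpose_transpose, Matrix.diagonal_transpose,
    Matrix.mul_assoc, ← Matrix.mul_assoc (Matrix.diagonal _), Matrix.diagonal_mul_diagonal,
    ← Matrix.mul_assoc]
  congr 3
  funext i
  rw [← mul_inv, Real.mul_self_sqrt (hlam i).le]

theorem coloring_mul_diagonal_mul (hlam : ∀ i, 0 < lam i) (d : Fin n → ℝ) :
    coloring U lam * Matrix.diagonal d * (coloring U lam).transpose =
      U * Matrix.diagonal (fun i => d i * lam i) * U.transpose := by
  rw [coloring, Matrix.transpose_mul, Matrix.diagonal_transpose, ← Matrix.mul_assoc,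
    Matrix.mul_assoc U, Matrix.mul_assoc U, Matrix.diagonal_mul_diagonal,
    Matrix.diagonal_mul_diagonal]
  congr 3
  funext i
  rw [mul_right_comm, Real.mul_self_sqrt (hlam i).le, mul_comm]

theorem sldFisher_eq_symInner (i j : Fin n) :
    M.sldFisher θ L i j = symInner (M.ρ θ) (L i) (L j) := rfl

/-- The whitened SLD operators are orthonormal. -/
theorem symInner_whitening (hU : U.transpose * U = 1) (hlam : ∀ i, 0 < lam i)
    (hS : M.sldFisher θ L = U * Matrix.diagonal lam * U.transpose) (k l : Fin n) :
    symInner (M.ρ θ) (∑ j, whitening U lam k j • L j) (∑ j, whitening U lam l j • L j) =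
      if k = l then 1 else 0 := by
  have h1 : symInner (M.ρ θ) (∑ j, whitening U lam k j • L j) (∑ j, whitening U lam l j • L j) =
      (whitening U lam * M.sldFisher θ L * (whitening U lam).transpose) k l := by
    simp only [Matrix.mul_apply, Matrix.transpose_apply, map_sum, map_smul, LinearMap.sum_apply,
      LinearMap.smul_apply, smul_eq_mul, sldFisher_eq_symInner, Finset.sum_mul, Finset.mul_sum]
    refine Finset.sum_congr rfl fun j _ => Finset.sum_congr rfl fun i _ => ?_
    ring
  have hS' : M.sldFisher θ L = coloring U lam * (coloring U lam).transpose := by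
    have h := coloring_mul_diagonal_mul (U := U) hlam 1
    rw [Matrix.diagonal_one', Matrix.mul_one] at h
    rw [h, hS]
    simp
  have h2 : whitening U lam * coloring U lam = 1 :=
    mul_eq_one_comm.mp (coloring_mul_whitening hU hlam)
  rw [h1, hS', ← Matrix.mul_assoc, h2, Matrix.one_mul, ← Matrix.transpose_mul, h2,
    Matrix.transpose_one, Matrix.one_apply]

theorem isHermitian_whitening (hL : ∀ i, M.IsSLD θ i (L i)) (k : Fin n) :
    (∑ j, whitening U lam k j • L j).IsHermitian :=
  isHermitian_sum_smul (fun j => (hL j).1) _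

theorem symInner_whitening_one (hθ : θ ∈ M.Θ) (hL : ∀ i, M.IsSLD θ i (L i)) (k : Fin n) :
    symInner (M.ρ θ) (∑ j, whitening U lam k j • L j) 1 = 0 := by
  simp [map_sum, LinearMap.sum_apply, fun j => (hL j).symInner_one hθ]

theorem infoMatrix_whitening (hθ : θ ∈ M.Θ) (hL : ∀ i, M.IsSLD θ i (L i)) (P : Measurement) :
    infoMatrix (M.ρ θ) (fun k => ∑ j, whitening U lam k j • L j) P =
      whitening U lam * M.fisher θ P * (whitening U lam).transpose := by
  rw [infoMatrix_congruence, M.fisher_eq_infoMatrix hθ hL]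

theorem fisher_eq_coloring (hθ : θ ∈ M.Θ) (hL : ∀ i, M.IsSLD θ i (L i))
    (hU : U.transpose * U = 1) (hlam : ∀ i, 0 < lam i) (P : Measurement) :
    M.fisher θ P = coloring U lam *
      infoMatrix (M.ρ θ) (fun k => ∑ j, whitening U lam k j • L j) P *
        (coloring U lam).transpose := by
  have h := coloring_mul_whitening hU hlam
  rw [infoMatrix_whitening hθ hL]
  calc M.fisher θ P = (coloring U lam * whitening U lam) * M.fisher θ P *
        (coloring U lam * whitening U lam).transpose := by
        rw [h, Matrix.transpose_one, Matrix.one_mul, Matrix.mul_one]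
    _ = _ := by rw [Matrix.transpose_mul]; simp only [Matrix.mul_assoc]

/-- The Gill–Massar inequality `Tr (S⁻¹ J) ≤ 1` for a qubit measurement. -/
theorem trace_inv_mul_fisher_le_one (hθ : θ ∈ M.Θ) (hL : ∀ i, M.IsSLD θ i (L i))
    (hU : U.transpose * U = 1) (hlam : ∀ i, 0 < lam i)
    (hS : M.sldFisher θ L = U * Matrix.diagonal lam * U.transpose) (P : Measurement) :
    (U * Matrix.diagonal (fun i => (lam i)⁻¹) * U.transpose * M.fisher θ P).trace ≤ 1 := by
  have h := trace_infoMatrix_le_one (M.posSemidef θ hθ) (M.trace_eq_one θ hθ)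
    (isHermitian_whitening (U := U) (lam := lam) hL) (symInner_whitening_one hθ hL)
    (symInner_whitening hU hlam hS) P
  rwa [infoMatrix_whitening hθ hL, Matrix.mul_assoc, Matrix.trace_mul_comm,
    Matrix.mul_assoc, Matrix.trace_mul_comm, whitening_transpose_mul hlam] at h

/-- The whitened Fisher information has entries bounded by `1`, uniformly in the measurement. Hence
the integrals that define `fisherMeasure` converge. -/
theorem integrable_fisher (hθ : θ ∈ M.Θ) (hL : ∀ i, M.IsSLD θ i (L i))
    (hU : U.transpose * U = 1) (hlam : ∀ i, 0 < lam i)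
    (hS : M.sldFisher θ L = U * Matrix.diagonal lam * U.transpose)
    (ξ : ProbabilityMeasure Measurement) (i j : Fin n) :
    Integrable (fun P => M.fisher θ P i j) (ξ : Measure Measurement) := by
  refine Integrable.of_bound (M.measurable_fisher hθ i j).aestronglyMeasurable
    (∑ l, ∑ k, |coloring U lam i k| * |coloring U lam j l|)
    (Filter.Eventually.of_forall fun P => ?_)
  rw [fisher_eq_coloring hθ hL hU hlam, Real.norm_eq_abs, Matrix.mul_apply]
  refine (Finset.abs_sum_le_sum_abs _ _).trans (Finset.sum_le_sum fun l _ => ?_)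
  rw [Matrix.mul_apply, Matrix.transpose_apply, abs_mul, ← Finset.sum_mul]
  refine mul_le_mul_of_nonneg_right ?_ (abs_nonneg _)
  refine (Finset.abs_sum_le_sum_abs _ _).trans (Finset.sum_le_sum fun k _ => ?_)
  rw [abs_mul]
  refine mul_le_of_le_one_right (abs_nonneg _) ?_
  exact (abs_infoMatrix_apply_le_trace (M.posSemidef θ hθ) _ P k l).trans
    (trace_infoMatrix_le_one (M.posSemidef θ hθ) (M.trace_eq_one θ hθ)
      (isHermitian_whitening hL) (symInner_whitening_one hθ hL) (symInner_whitening hU hlam hS) P)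

theorem trace_inv_mul_fisherMixed_le_one (hθ : θ ∈ M.Θ) (hL : ∀ i, M.IsSLD θ i (L i))
    (hU : U.transpose * U = 1) (hlam : ∀ i, 0 < lam i)
    (hS : M.sldFisher θ L = U * Matrix.diagonal lam * U.transpose) {m : ℕ} (e : MixedDesign m) :
    (U * Matrix.diagonal (fun i => (lam i)⁻¹) * U.transpose * M.fisherMixed θ e).trace ≤ 1 := by
  rw [fisherMixed, Matrix.mul_sum, Matrix.trace_sum, ← e.weight_mem.2]
  refine Finset.sum_le_sum fun i _ => ?_
  rw [Matrix.mul_smul, Matrix.trace_smul, smul_eq_mul]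
  exact mul_le_of_le_one_right (e.weight_mem.1 i) (trace_inv_mul_fisher_le_one hθ hL hU hlam hS _)

theorem trace_inv_mul_fisherMeasure_le_one (hθ : θ ∈ M.Θ) (hL : ∀ i, M.IsSLD θ i (L i))
    (hU : U.transpose * U = 1) (hlam : ∀ i, 0 < lam i)
    (hS : M.sldFisher θ L = U * Matrix.diagonal lam * U.transpose)
    (ξ : ProbabilityMeasure Measurement) :
    (U * Matrix.diagonal (fun i => (lam i)⁻¹) * U.transpose * M.fisherMeasure θ ξ).trace ≤ 1 := by
  set R := U * Matrix.diagonal (fun i => (lam i)⁻¹) * U.transpose with hR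
  have hint : ∀ i j, Integrable (fun P => R i j * M.fisher θ P j i) (ξ : Measure Measurement) :=
    fun i j => (integrable_fisher hθ hL hU hlam hS ξ j i).const_mul _
  have h1 : (R * M.fisherMeasure θ ξ).trace =
      ∫ P, (R * M.fisher θ P).trace ∂(ξ : Measure Measurement) := by
    simp only [Matrix.trace, Matrix.diag_apply, Matrix.mul_apply]
    rw [integral_finsetSum _ fun i _ => integrable_finsetSum _ fun j _ => hint i j]
    refine Finset.sum_congr rfl fun i _ => ?_
    rw [integral_finsetSum _ fun j _ => hint i j]
    refine Finset.sum_congr rfl fun j _ => ?_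
    rw [integral_const_mul]
    rfl
  have h2 : Integrable (fun P => (R * M.fisher θ P).trace) (ξ : Measure Measurement) := by
    simp only [Matrix.trace, Matrix.diag_apply, Matrix.mul_apply]
    exact integrable_finsetSum _ fun i _ => integrable_finsetSum _ fun j _ => hint i j
  rw [h1]
  refine (integral_mono h2 (integrable_const (1 : ℝ)) fun P =>
    trace_inv_mul_fisher_le_one hθ hL hU hlam hS P).trans ?_
  simp

/-- The observable `L_{u_k}` is the `k`th whitened SLD operator. -/
theorem sldObservable_eq_whitening (hU : U.transpose * U = 1)
    (hS : M.sldFisher θ L = U * Matrix.diagonal lam * U.transpose)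
    (hlam : ∀ i, 0 < lam i) (k : Fin n) {v : EuclideanSpace ℝ (Fin n)} (hv : ∀ i, v i = U i k) :
    M.sldObservable θ L v = ∑ j, whitening U lam k j • L j := by
  have hB : U.transpose * matPow (M.sldFisher θ L) (-1 / 2) = whitening U lam := by
    rw [hS, matPow_conj_diagonal hU, ← Matrix.mul_assoc, ← Matrix.mul_assoc, hU, Matrix.one_mul,
      whitening]
    congr 2
    funext i
    rw [Real.sqrt_eq_rpow, ← Real.rpow_neg (hlam i).le]
    norm_num
  rw [sldObservable, Finset.sum_comm]
  refine Finset.sum_congr rfl fun j _ => ?_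
  rw [← Finset.sum_smul, ← hB, Matrix.mul_apply, ← Complex.ofReal_sum, Complex.coe_smul]
  simp only [hv, Matrix.transpose_apply]

end QubitModel

/-! ### Optimal designs -/

section Designs

variable {n : ℕ} {M : QubitModel n} {θ : EuclideanSpace ℝ (Fin n)}
  {L : Fin n → Matrix (Fin 2) (Fin 2) ℂ} {U : Matrix (Fin n) (Fin n) ℝ} {lam : Fin n → ℝ} {γ : ℝ}

theorem MixedDesign.IsGammaDesign.fisherMixed_eq (hθ : θ ∈ M.Θ) (hL : ∀ i, M.IsSLD θ i (L i))
    (hγ' : -1 < γ) (hU : U.transpose * U = 1) (hlam : ∀ i, 0 < lam i)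
    (hS : M.sldFisher θ L = U * Matrix.diagonal lam * U.transpose)
    {u : Fin n → EuclideanSpace ℝ (Fin n)} (hu : ∀ k i, u k i = U i k) {e : MixedDesign n}
    (he : e.IsGammaDesign γ M θ L u lam) :
    M.fisherMixed θ e = gammaFisher γ (M.sldFisher θ L) := by
  have hg : γ + 1 ≠ 0 := by linarith
  have hJ : ∀ i, M.fisher θ (e.meas i) =
      QubitModel.coloring U lam * Matrix.diagonal (Pi.single i 1) *
        (QubitModel.coloring U lam).transpose := by
    intro i
    have hP := (he i).1
    rw [QubitModel.sldObservable_eq_whitening hU hS hlam i (hu i)] at hP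
    rw [QubitModel.fisher_eq_coloring hθ hL hU hlam,
      infoMatrix_of_isProjectiveFor (M.posSemidef θ hθ) (M.trace_eq_one θ hθ)
        (QubitModel.isHermitian_whitening hL) (QubitModel.symInner_whitening_one hθ hL)
        (QubitModel.symInner_whitening hU hlam hS) hP]
  have hsum : ∑ i, e.weight i • Matrix.diagonal (Pi.single i (1 : ℝ)) =
      Matrix.diagonal e.weight := by
    ext k l
    rw [Matrix.sum_apply, Finset.sum_eq_single k]
    · by_cases hkl : k = l
      · subst hkl; simp
      · simp [hkl]
    · intro b _ hb
      rw [Matrix.smul_apply, Matrix.diagonal_apply, Pi.single_eq_of_ne hb.symm]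
      simp
    · simp
  have h1 : M.fisherMixed θ e = QubitModel.coloring U lam * Matrix.diagonal e.weight *
      (QubitModel.coloring U lam).transpose := by
    rw [← hsum, Matrix.mul_sum, Matrix.sum_mul, QubitModel.fisherMixed]
    refine Finset.sum_congr rfl fun i _ => ?_
    rw [hJ, Matrix.mul_smul, Matrix.smul_mul]
  rw [h1, QubitModel.coloring_mul_diagonal_mul hlam, hS, gammaFisher_conj_diagonal hU,
    gammaTrace_conj_diagonal hU]
  congr 3
  funext i
  rw [(he i).2, div_mul_eq_mul_div, ← Real.rpow_add_one (hlam i).ne', div_eq_inv_mul]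
  congr 2
  field_simp
  ring

theorem exists_isGammaDesign (hn : 0 < n) (hL : ∀ i, M.IsSLD θ i (L i))
    (hU : U.transpose * U = 1) (hlam : ∀ i, 0 < lam i)
    (hS : M.sldFisher θ L = U * Matrix.diagonal lam * U.transpose)
    {u : Fin n → EuclideanSpace ℝ (Fin n)} (hu : ∀ k i, u k i = U i k) (γ : ℝ) :
    ∃ e : MixedDesign n, e.IsGammaDesign γ M θ L u lam := by
  have hex : ∀ k, ∃ P : Measurement, P.IsProjectiveFor (M.sldObservable θ L (u k)) := by
    intro k
    rw [QubitModel.sldObservable_eq_whitening hU hS hlam k (hu k)]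
    exact (QubitModel.isHermitian_whitening hL k).exists_isProjectiveFor
  choose P hP using hex
  have hT := gammaTrace_pos (γ := γ) hn hU hlam
  rw [gammaTrace_conj_diagonal hU] at hT
  refine ⟨⟨fun i => lam i ^ (-(γ / (γ + 1))) / ∑ j, lam j ^ (-(γ / (γ + 1))), ⟨fun i => ?_, ?_⟩,
    P⟩, fun i => ⟨hP i, rfl⟩⟩
  · exact div_nonneg (Real.rpow_pos_of_pos (hlam i) _).le hT.le
  · rw [← Finset.sum_div, div_self hT.ne']

/-- A mixed design is a finitely supported design measure. -/
theorem exists_fisherMeasure_eq_fisherMixed (hθ : θ ∈ M.Θ) {m : ℕ} (e : MixedDesign m) :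
    ∃ ξ : ProbabilityMeasure Measurement, M.fisherMeasure θ ξ = M.fisherMixed θ e := by
  set ν : Measure Measurement := ∑ i, ENNReal.ofReal (e.weight i) • Measure.dirac (e.meas i) with hν
  have hprob : IsProbabilityMeasure ν := by
    constructor
    rw [hν, Measure.finsetSum_apply]
    simp only [Measure.smul_apply, measure_univ, smul_eq_mul, mul_one]
    rw [← ENNReal.ofReal_sum_of_nonneg fun i _ => e.weight_mem.1 i, e.weight_mem.2,
      ENNReal.ofReal_one]
  refine ⟨⟨ν, hprob⟩, ?_⟩
  ext i j
  have hm := (M.measurable_fisher hθ i j).stronglyMeasurable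
  change ∫ P, M.fisher θ P i j ∂ν = _
  rw [hν, integral_finsetSum_measure, QubitModel.fisherMixed, Matrix.sum_apply]
  · refine Finset.sum_congr rfl fun k _ => ?_
    rw [integral_smul_measure, integral_dirac' _ _ hm, ENNReal.toReal_ofReal (e.weight_mem.1 k)]
    rfl
  · intro k _
    exact (integrable_dirac' hm (by simp)).smul_measure ENNReal.ofReal_ne_top

/-- In a class of designs that obey the information bound and among which `gammaFisher` is
attained, the minimum of the criterion is `gammaMinimum` and the optimal designs are those with
information matrix `gammaFisher`. -/
theorem optimalDesigns_of_attained (hn : 0 < n) (hγ : γ ≠ 0) (hγ' : -1 < γ)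
    (hU : U.transpose * U = 1) (hlam : ∀ i, 0 < lam i) {D : Type*}
    {J : D → Matrix (Fin n) (Fin n) ℝ}
    (htr : ∀ e, (U * Matrix.diagonal (fun i => (lam i)⁻¹) * U.transpose * J e).trace ≤ 1)
    (hatt : ∃ e, J e = gammaFisher γ (U * Matrix.diagonal lam * U.transpose)) :
    IsLeast (regularValues (gammaCriterion γ) J)
        (gammaMinimum γ (U * Matrix.diagonal lam * U.transpose)) ∧
      ∀ e, IsOptimalDesign (gammaCriterion γ) J e ↔
        J e = gammaFisher γ (U * Matrix.diagonal lam * U.transpose) := by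
  have hpd := gammaFisher_posDef (γ := γ) hn hU hlam
  have hval := gammaCriterion_gammaFisher (γ := γ) hn hγ' hU hlam
  have hle : ∀ e, (J e).PosDef →
      gammaMinimum γ (U * Matrix.diagonal lam * U.transpose) ≤ gammaCriterion γ (J e) :=
    fun e he => (gammaMinimum_le_gammaCriterion hn hγ hγ' hU hlam he (htr e)).1
  obtain ⟨e₀, he₀⟩ := hatt
  refine ⟨⟨⟨e₀, by rwa [he₀], by rw [he₀, hval]⟩, ?_⟩, fun e => ⟨fun he => ?_, fun he => ?_⟩⟩
  · rintro v ⟨e, he, rfl⟩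
    exact hle e he
  · refine (gammaMinimum_le_gammaCriterion hn hγ hγ' hU hlam he.1 (htr e)).2 (le_antisymm ?_
      (hle e he.1))
    have h := he.2 e₀ (by rwa [he₀])
    rwa [he₀, hval] at h
  · refine ⟨by rwa [he], fun e' he' => ?_⟩
    rw [he, hval]
    exact hle e' he'

theorem orthogonal_of_orthonormalBasis
    (u : OrthonormalBasis (Fin n) ℝ (EuclideanSpace ℝ (Fin n))) :
    (Matrix.of fun i k => u k i).transpose * (Matrix.of fun i k => u k i) = 1 := by
  ext k l
  have h := orthonormal_iff_ite.1 u.orthonormal k l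
  rw [PiLp.inner_apply] at h
  rw [Matrix.mul_apply, Matrix.one_apply, ← h]
  refine Finset.sum_congr rfl fun i _ => ?_
  simp [mul_comm]

theorem eq_conj_diagonal_of_mulVec {S : Matrix (Fin n) (Fin n) ℝ}
    {u : OrthonormalBasis (Fin n) ℝ (EuclideanSpace ℝ (Fin n))}
    (h : ∀ i, S.mulVec (u i) = lam i • (u i : Fin n → ℝ)) :
    S = (Matrix.of fun i k => u k i) * Matrix.diagonal lam *
      (Matrix.of fun i k => u k i).transpose := by
  have hU := mul_eq_one_comm.mp (orthogonal_of_orthonormalBasis u)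
  have h1 : S * (Matrix.of fun i k => u k i) =
      (Matrix.of fun i k => u k i) * Matrix.diagonal lam := by
    ext i k
    have := congrFun (h k) i
    rw [Matrix.mul_diagonal, mul_comm]
    exact this
  rw [← h1, Matrix.mul_assoc, hU, Matrix.mul_one]

end Designs

end

theorem mainTheorem2 {n : ℕ} (hn : n = 2 ∨ n = 3) {γ : ℝ} (hγ : γ ≠ 0) (hγ' : -1 < γ)
    (M : QubitModel n) (θ : EuclideanSpace ℝ (Fin n)) (hθ : θ ∈ M.Θ)
    (L : Fin n → Matrix (Fin 2) (Fin 2) ℂ) (hL : ∀ i, M.IsSLD θ i (L i))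
    (hreg : (M.sldFisher θ L).PosDef) :
    -- the minimum, over mixtures of `n` measurements and over all design measures
    IsLeast (regularValues (gammaCriterion γ) (fun e : MixedDesign n => M.fisherMixed θ e))
      (gammaMinimum γ (M.sldFisher θ L)) ∧
    IsLeast (regularValues (gammaCriterion γ) (M.fisherMeasure θ))
      (gammaMinimum γ (M.sldFisher θ L)) ∧
    -- the mixture of projective measurements along the SLD eigenvectors exists and is optimal
    (∀ (u : OrthonormalBasis (Fin n) ℝ (EuclideanSpace ℝ (Fin n))) (lam : Fin n → ℝ),
      (∀ i, (M.sldFisher θ L).mulVec (u i) = lam i • (u i : Fin n → ℝ)) →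
      (∃ e : MixedDesign n, e.IsGammaDesign γ M θ L u lam) ∧
      ∀ e : MixedDesign n, e.IsGammaDesign γ M θ L u lam →
        IsOptimalDesign (gammaCriterion γ) (fun e' : MixedDesign n => M.fisherMixed θ e') e ∧
        gammaCriterion γ (M.fisherMixed θ e) = gammaMinimum γ (M.sldFisher θ L)) ∧
    -- the necessary and sufficient condition for optimality
    (∀ e : MixedDesign n,
      IsOptimalDesign (gammaCriterion γ) (fun e' : MixedDesign n => M.fisherMixed θ e') e ↔
        M.fisherMixed θ e = gammaFisher γ (M.sldFisher θ L)) ∧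
    (∀ ξ : ProbabilityMeasure Measurement,
      IsOptimalDesign (gammaCriterion γ) (M.fisherMeasure θ) ξ ↔
        M.fisherMeasure θ ξ = gammaFisher γ (M.sldFisher θ L)) := by
  have hn0 : 0 < n := by rcases hn with rfl | rfl <;> norm_num
  -- The design built from any eigenbasis attains `gammaFisher`. One eigenbasis suffices for the
  -- minimum over both classes, but the design is to be optimal for each of them.
  have key : ∀ (u : OrthonormalBasis (Fin n) ℝ (EuclideanSpace ℝ (Fin n))) (lam : Fin n → ℝ),
      (∀ i, (M.sldFisher θ L).mulVec (u i) = lam i • (u i : Fin n → ℝ)) →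
      (∃ e : MixedDesign n, e.IsGammaDesign γ M θ L u lam) ∧
      ∀ e : MixedDesign n, e.IsGammaDesign γ M θ L u lam →
        M.fisherMixed θ e = gammaFisher γ (M.sldFisher θ L) := by
    intro u lam hu
    have hU := orthogonal_of_orthonormalBasis u
    have hS := eq_conj_diagonal_of_mulVec hu
    have hlam : ∀ i, 0 < lam i := (posDef_conj_diagonal_iff hU lam).1 (hS ▸ hreg)
    exact ⟨exists_isGammaDesign hn0 hL hU hlam hS (fun _ _ => rfl) γ,
      fun e he => he.fisherMixed_eq hθ hL hγ' hU hlam hS (fun _ _ => rfl)⟩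
  have hu₀ := hreg.1.mulVec_eigenvectorBasis
  obtain ⟨⟨e₀, he₀⟩, hJ₀⟩ := key _ _ hu₀
  replace hJ₀ := hJ₀ e₀ he₀
  have hU := orthogonal_of_orthonormalBasis hreg.1.eigenvectorBasis
  have hS := eq_conj_diagonal_of_mulVec hu₀
  have hlam := hreg.eigenvalues_pos
  obtain ⟨hmix1, hmix2⟩ := optimalDesigns_of_attained (γ := γ) hn0 hγ hγ' hU hlam
    (J := fun e : MixedDesign n => M.fisherMixed θ e)
    (QubitModel.trace_inv_mul_fisherMixed_le_one hθ hL hU hlam hS) ⟨e₀, by rwa [← hS]⟩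
  obtain ⟨ξ₀, hξ₀⟩ := exists_fisherMeasure_eq_fisherMixed hθ e₀
  obtain ⟨hmeas1, hmeas2⟩ := optimalDesigns_of_attained (γ := γ) hn0 hγ hγ' hU hlam
    (J := M.fisherMeasure θ)
    (QubitModel.trace_inv_mul_fisherMeasure_le_one hθ hL hU hlam hS)
    ⟨ξ₀, by rwa [hξ₀, ← hS]⟩
  have hval := gammaCriterion_gammaFisher (γ := γ) hn0 hγ' hU hlam
  rw [← hS] at hmix1 hmix2 hmeas1 hmeas2 hval
  refine ⟨hmix1, hmeas1, fun u lam hu => ⟨(key u lam hu).1, fun e he => ?_⟩, hmix2, hmeas2⟩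
  have hJ := (key u lam hu).2 e he
  exact ⟨(hmix2 e).2 hJ, by rw [hJ, hval]⟩
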